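/- Let $d\ge 3$. For $R>0$ let $\mathbf B_R\subset\mathbb R^d$ be the open Euclidean ball of radius $R$ centred at the origin, $\overline{\mathbf B}_R$ its closure, and $\mathcal B_R=\mathbf B_R\cap\mathbb Z^d$. For a closed set $T\subset S^{d-1}=\{x\in\mathbb R^d:\|x\|_2=1\}$ let $K(T)=\{x\in\mathbb R^d: x\neq 0,\ x/\|x\|_2\in T\}$ be the infinite cone determined by $T$ and the origin. There is a finite constant $R_1=R_1(d)$ such that for all $\delta,c_p>1$ there is a finite constant $C'=C'(d,\delta,c_p)$ for which the following holds. Let $R>1$ with $R>R_1$, put $R^+=R+\delta\sqrt{\log R}$, let $T\subset S^{d-1}$ be closed with $\|x-y\|_2\le c_p/R$ for all $x,y\in T$, and let $\mathcal C=(\overline{\mathbf B}_{R^+}\setminus\mathbf B_R)\cap K(T)\cap\mathbb Z^d$ be the discrete cell determined by the annulus $\overline{\mathbf B}_{R^+}\setminus\mathbf B_R$ and $T$. If $Y=(Y_n)_{n\ge 0}$ is a simple random walk on $\mathbb Z^d$ started at the origin, then $$\mathbb P_{\mathbf 0}\bigl(Y\text{ hits }\mathcal C\text{ before }\mathcal B_{R^+}^c\bigr)\le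 C'\,\frac{\log R}{R^{d-1}},$$ where the event means that there is a time $k\ge 0$ with $Y_k\in\mathcal C$ and $Y_j\in\mathcal B_{R^+}$ for all $j<k$ (so a first exit from $\mathcal B_{R^+}$ at a point of $\mathcal C$ is counted as well). -/

import Mathlib

open MeasureTheory ProbabilityTheory

noncomputable section

namespace SRWCell

/-- The point of the Euclidean space `ℝ^d` that corresponds to a vertex of `ℤ^d`. -/
def toEuclid {d : ℕ} (x : Fin d → ℤ) : EuclideanSpace ℝ (Fin d) :=
  WithLp.toLp 2 (fun i => (x i : ℝ))

/-- The infinite cone `K(T) = {x : x / ‖x‖ ∈ T}`; for `T` in the unit sphere it does not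
contain the origin. -/
def cone {d : ℕ} (T : Set (EuclideanSpace ℝ (Fin d))) : Set (EuclideanSpace ℝ (Fin d)) :=
  {x | ‖x‖⁻¹ • x ∈ T}

/-- The annulus `A(R, R')`: the closed ball of (outer) radius `R` minus the open ball of (inner)
radius `R'`, both centred at the origin. -/
def annulus (d : ℕ) (R R' : ℝ) : Set (EuclideanSpace ℝ (Fin d)) :=
  Metric.closedBall 0 R \ Metric.ball 0 R'

/-- The cell `C(A, T) = A ∩ K(T)`. -/
def cell {d : ℕ} (A T : Set (EuclideanSpace ℝ (Fin d))) : Set (EuclideanSpace ℝ (Fin d)) :=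
  A ∩ cone T

/-- The trace `S ∩ ℤ^d` on the lattice of a subset `S` of `ℝ^d`. -/
def lattice {d : ℕ} (S : Set (EuclideanSpace ℝ (Fin d))) : Set (Fin d → ℤ) :=
  {x | toEuclid x ∈ S}

/-- The lattice ball `B_R`: the lattice points of the open Euclidean ball of radius `R` centred
at the origin. -/
def latticeBall (d : ℕ) (R : ℝ) : Set (Fin d → ℤ) :=
  lattice (Metric.ball (0 : EuclideanSpace ℝ (Fin d)) R)

/-- Under the measure `μ`, the process `Y` is a (discrete time, nearest neighbour) simple random
walk on `ℤ^d` started at `v`: its increments are independent, and each of them is uniformly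
distributed on the `2 d` unit vectors `± e_i`. -/
structure IsSimpleRandomWalk {Ω : Type*} [MeasurableSpace Ω] (μ : Measure Ω) {d : ℕ}
    (v : Fin d → ℤ) (Y : ℕ → Ω → (Fin d → ℤ)) : Prop where
  measurable : ∀ n, Measurable (Y n)
  start : ∀ᵐ ω ∂μ, Y 0 ω = v
  indep : iIndepFun (fun n ω => Y (n + 1) ω - Y n ω) μ
  step_pos : ∀ (n : ℕ) (i : Fin d),
    μ.real {ω | Y (n + 1) ω - Y n ω = Pi.single i 1} = 1 / (2 * (d : ℝ))
  step_neg : ∀ (n : ℕ) (i : Fin d),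
    μ.real {ω | Y (n + 1) ω - Y n ω = -Pi.single i 1} = 1 / (2 * (d : ℝ))

/-- The trajectory `y` hits `A` before `B`: it visits `A` at some time `k` and has not visited `B`
at any earlier time. When `A` and `B` meet, a simultaneous first visit to both of them, at a
common point, is counted as well. -/
def HitsBefore {α : Type*} (y : ℕ → α) (A B : Set α) : Prop :=
  ∃ k, y k ∈ A ∧ ∀ j < k, y j ∉ B

end SRWCell

end

/-
A union bound over the points of the cell and over the hitting times bounds the probability by the
sum, over the cell, of the Green function of the walk killed on leaving the ball of radius
`ρ = R + δ √(log R)`. With `F x = (|x|² + b) ^ (-(d - 2) / 2)` and `b` large, `F` is strictly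
superharmonic on the whole lattice, so a multiple of `F - m`, where `m` is the value of `F` at
radius `ρ + 1`, is a supersolution that dominates the killed Green function. In the cell `F - m` is
`O(√(log R) / R ^ (d - 1))`, and the cell has `O(√(log R))` points because `T` has diameter
`O(1 / R)`.
-/

namespace SRWCell

open Filter Topology

section NegativePowers

lemma rpow_neg_sub_rpow_neg_le {a s u : ℝ} (ha : 0 ≤ a) (hs : 0 < s) (hu : 0 < u) :
    s ^ (-a) - u ^ (-a) ≤ a * s ^ (-(a + 1)) * (u - s) := by
  have hus : 0 < u / s := div_pos hu hs
  have hu_eq : u ^ (-a) = s ^ (-a) * (u / s) ^ (-a) := by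
    rw [← Real.mul_rpow hs.le hus.le, mul_div_cancel₀ _ hs.ne']
  have hs_eq : s ^ (-(a + 1)) = s ^ (-a) / s := by
    rw [neg_add, ← sub_eq_add_neg, Real.rpow_sub_one hs.ne']
  have bernoulli : 1 - (u / s) ^ (-a) ≤ a * (u / s - 1) :=
    calc 1 - (u / s) ^ (-a) ≤ a * Real.log (u / s) := by
          rw [Real.rpow_def_of_pos hus]
          linarith [Real.add_one_le_exp (Real.log (u / s) * -a)]
      _ ≤ a * (u / s - 1) := by gcongr; exact Real.log_le_sub_one_of_pos hus
  calc s ^ (-a) - u ^ (-a) = s ^ (-a) * (1 - (u / s) ^ (-a)) := by rw [hu_eq]; ring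
    _ ≤ s ^ (-a) * (a * (u / s - 1)) := by gcongr
    _ = a * s ^ (-(a + 1)) * (u - s) := by rw [hs_eq]; field_simp

lemma rpow_neg_mul_one_add_div_le {a q : ℝ} (ha : 0 ≤ a) (hq : 1 < q) :
    q ^ (-a) * (1 + a / q) ≤ (q - 1) ^ (-a) :=
  calc q ^ (-a) * (1 + a / q) = q ^ (-a) - a * q ^ (-(a + 1)) * (q - 1 - q) := by
        rw [neg_add, ← sub_eq_add_neg, Real.rpow_sub_one (by positivity)]; ring
    _ ≤ (q - 1) ^ (-a) :=
        sub_le_comm.1 (rpow_neg_sub_rpow_neg_le ha (by linarith) (by linarith))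

lemma ringChoose_two (r : ℝ) : Ring.choose r 2 = r * (r - 1) / 2 := by
  have h := Ring.descPochhammer_eq_factorial_smul_choose r 2
  simp only [descPochhammer_succ_right, descPochhammer_zero, Polynomial.smeval_mul,
    Polynomial.smeval_sub, Polynomial.smeval_one, Polynomial.smeval_X, Polynomial.smeval_natCast,
    Nat.factorial] at h
  simp only [pow_zero, one_smul, pow_one, Nat.cast_zero, sub_zero, one_mul, Nat.succ_eq_add_one,
    Nat.reduceAdd, zero_add, mul_one, nsmul_eq_mul, Nat.cast_ofNat] at h
  linarith

lemma exists_one_add_rpow_add_one_sub_rpow_le (r : ℝ) :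
    ∃ K, 0 < K ∧ ∀ᶠ t in 𝓝 (0 : ℝ),
      (1 + t) ^ r + (1 - t) ^ r ≤ 2 + r * (r - 1) * t ^ 2 + K * t ^ 4 := by
  obtain ⟨c, hc, hbound⟩ :=
    ((Real.one_add_rpow_hasFPowerSeriesAt_zero (a := r)).isBigO_sub_partialSum_pow 4).exists_pos
  have hneg : Tendsto (fun t : ℝ => -t) (𝓝 0) (𝓝 0) := by
    simpa using (continuous_neg (G := ℝ)).tendsto 0
  refine ⟨2 * c, by positivity, ?_⟩
  filter_upwards [hbound.bound, hneg.eventually hbound.bound] with t h_pos h_neg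
  simp only [FormalMultilinearSeries.partialSum, Finset.sum_range_succ, Finset.sum_range_zero,
    binomialSeries_apply, Ring.choose_zero_right, Ring.choose_one_right, ringChoose_two,
    List.ofFn_const, List.prod_replicate, smul_eq_mul, zero_add, Real.norm_eq_abs, abs_pow,
    abs_neg, Even.pow_abs (n := 4) (by decide)] at h_pos h_neg
  rw [← sub_eq_add_neg] at h_neg
  linarith [(abs_le.1 h_pos).2, (abs_le.1 h_neg).2]

/-- The error is stated relative to `y ^ 2` so that it can be summed over the coordinates `y` of
a lattice point. -/
lemma exists_eventually_add_rpow_add_sub_rpow_le (a : ℝ) :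
    ∃ K, 0 < K ∧ ∀ᶠ q in atTop, ∀ y : ℝ, y ^ 2 ≤ q →
      (q + 2 * y) ^ (-a) + (q - 2 * y) ^ (-a)
        ≤ q ^ (-a) * (2 + (4 * a * (a + 1) / q ^ 2 + K / q ^ 3) * y ^ 2) := by
  obtain ⟨K, hK, hexpand⟩ := exists_one_add_rpow_add_one_sub_rpow_le (-a)
  obtain ⟨η, hη, hexpand⟩ := Metric.eventually_nhds_iff.1 hexpand
  refine ⟨16 * K, by positivity, ?_⟩
  filter_upwards [eventually_gt_atTop (4 / η ^ 2), eventually_gt_atTop 4] with q hqη hq4 y hy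
  have hq : 0 < q := by linarith
  set t : ℝ := 2 * y / q
  have ht : t ^ 2 ≤ 4 / q := by
    rw [div_pow, div_le_div_iff₀ (by positivity) hq]
    nlinarith
  have htη : |t| < η := by
    refine abs_lt_of_sq_lt_sq (ht.trans_lt ?_) hη.le
    rwa [div_lt_comm₀ hq (by positivity)]
  have ht1 : |t| ≤ 1 := by
    refine abs_le_of_sq_le_sq (ht.trans ?_) zero_le_one
    rw [one_pow, div_le_one hq]
    exact hq4.le
  have h_add : q + 2 * y = q * (1 + t) := by simp only [t]; field_simp
  have h_sub : q - 2 * y = q * (1 - t) := by simp only [t]; field_simp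
  rw [h_add, h_sub, Real.mul_rpow hq.le (by linarith [(abs_le.1 ht1).1]),
    Real.mul_rpow hq.le (by linarith [(abs_le.1 ht1).2]), ← mul_add]
  refine mul_le_mul_of_nonneg_left ?_ (by positivity)
  calc (1 + t) ^ (-a) + (1 - t) ^ (-a)
      ≤ 2 + -a * (-a - 1) * t ^ 2 + K * t ^ 4 := hexpand (by simpa using htη)
    _ = 2 + a * (a + 1) * t ^ 2 + K * (t ^ 2 * t ^ 2) := by ring
    _ ≤ 2 + a * (a + 1) * t ^ 2 + K * (4 / q * t ^ 2) := by gcongr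
    _ = 2 + (4 * a * (a + 1) / q ^ 2 + 16 * K / q ^ 3) * y ^ 2 := by
        simp only [t]; field_simp; ring

end NegativePowers

variable {d : ℕ}

section NeighborMean

/-- The transition operator of simple random walk: the mean of `f` over the `2 d` neighbours
`x ± e_i` of `x`. The two signs are encoded as the units of `ℤ`. -/
noncomputable def neighborMean (f : (Fin d → ℤ) → ℝ) (x : Fin d → ℤ) : ℝ :=
  (2 * d : ℝ)⁻¹ * ∑ i, ∑ ε : ℤˣ, f (x + Pi.single i (ε : ℤ))

lemma sum_units_int {M : Type*} [AddCommMonoid M] (f : ℤˣ → M) : ∑ ε, f ε = f 1 + f (-1) := by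
  rw [UnitsInt.univ, Finset.sum_pair (by decide)]

lemma neighborMean_le_neighborMean {f g : (Fin d → ℤ) → ℝ} {x : Fin d → ℤ}
    (h : ∀ i, ∀ ε : ℤˣ, f (x + Pi.single i (ε : ℤ)) ≤ g (x + Pi.single i (ε : ℤ))) :
    neighborMean f x ≤ neighborMean g x := by
  unfold neighborMean
  gcongr with i _ ε _
  exact h i ε

lemma sum_neighborMean {ι : Type*} (s : Finset ι) (f : ι → (Fin d → ℤ) → ℝ) (x : Fin d → ℤ) :
    ∑ n ∈ s, neighborMean (f n) x = neighborMean (fun y => ∑ n ∈ s, f n y) x := by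
  simp only [neighborMean, ← Finset.mul_sum]
  rw [Finset.sum_comm]
  simp only [Finset.sum_comm (s := s)]

lemma neighborMean_mul_sub (hd : 0 < d) (A m : ℝ) (F : (Fin d → ℤ) → ℝ) (x : Fin d → ℤ) :
    neighborMean (fun y => A * (F y - m)) x = A * (neighborMean F x - m) := by
  simp only [neighborMean, ← Finset.mul_sum, Finset.sum_sub_distrib, Finset.sum_const,
    Finset.card_univ, Fintype.card_fin, Fintype.card_units_int, nsmul_eq_mul]
  field_simp
  push_cast
  ring

/-- The partial sums satisfy `G (N + 1) ≤ g + neighborMean (1_B (G N))`, so every supersolution `H`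
of the corresponding equation dominates them. -/
lemma sum_range_le_of_supersolution {B : Set (Fin d → ℤ)} {p : ℕ → (Fin d → ℤ) → ℝ}
    {g H : (Fin d → ℤ) → ℝ} (hp_zero : ∀ x ∈ B, p 0 x ≤ g x)
    (hp_succ : ∀ n, ∀ x ∈ B, p (n + 1) x ≤ neighborMean (B.indicator (p n)) x)
    (hH_nonneg : ∀ x ∈ B, 0 ≤ H x) (hH : ∀ x ∈ B, g x + neighborMean (B.indicator H) x ≤ H x)
    (N : ℕ) : ∀ x ∈ B, ∑ n ∈ Finset.range N, p n x ≤ H x := by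
  classical
  induction N with
  | zero => simpa using hH_nonneg
  | succ N ih =>
    intro x hx
    have htail : ∑ n ∈ Finset.range N, p (n + 1) x ≤ neighborMean (B.indicator H) x :=
      calc ∑ n ∈ Finset.range N, p (n + 1) x
          ≤ ∑ n ∈ Finset.range N, neighborMean (B.indicator (p n)) x := by
            gcongr with n; exact hp_succ n x hx
        _ = neighborMean (fun y => ∑ n ∈ Finset.range N, B.indicator (p n) y) x :=
            sum_neighborMean _ _ x
        _ ≤ neighborMean (B.indicator H) x := neighborMean_le_neighborMean fun i ε => by
            by_cases hB : x + Pi.single i (ε : ℤ) ∈ B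
            · simpa only [Set.indicator_of_mem hB] using ih _ hB
            · simp only [Set.indicator_of_notMem hB, Finset.sum_const_zero, le_refl]
    rw [Finset.sum_range_succ']
    linarith [hp_zero x hx, hH x hx]

end NeighborMean

section Potential

lemma toEuclid_add_single (x : Fin d → ℤ) (i : Fin d) (k : ℤ) :
    toEuclid (x + Pi.single i k) = toEuclid x + EuclideanSpace.single i (k : ℝ) := by
  ext j
  by_cases hj : j = i
  · subst hj; simp [toEuclid]
  · simp [toEuclid, hj]

lemma norm_toEuclid_add_single_sq (x : Fin d → ℤ) (i : Fin d) (k : ℤ) :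
    ‖toEuclid (x + Pi.single i k)‖ ^ 2 = ‖toEuclid x‖ ^ 2 + 2 * k * x i + k ^ 2 := by
  rw [toEuclid_add_single, norm_add_sq_real, EuclideanSpace.inner_single_right, PiLp.norm_single,
    Real.norm_eq_abs, sq_abs]
  simp [toEuclid, mul_assoc]

lemma norm_toEuclid_add_single_le (x : Fin d → ℤ) (i : Fin d) (ε : ℤˣ) :
    ‖toEuclid (x + Pi.single i (ε : ℤ))‖ ≤ ‖toEuclid x‖ + 1 := by
  have hunit : ‖EuclideanSpace.single i ((ε : ℤ) : ℝ)‖ = 1 := by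
    rw [PiLp.norm_single]
    obtain rfl | rfl := Int.units_eq_one_or ε <;> simp
  rw [toEuclid_add_single, ← hunit]
  exact norm_add_le _ _

/-- The regularised Newtonian potential `x ↦ (|x|² + b) ^ (-a)`. The Newtonian exponent is
`a = (d - 2) / 2`, and the shift `b` makes the function superharmonic near the origin too. -/
noncomputable def potential (b a : ℝ) (x : Fin d → ℤ) : ℝ :=
  (‖toEuclid x‖ ^ 2 + b) ^ (-a)

lemma sum_units_potential_add_single (b a : ℝ) (x : Fin d → ℤ) (i : Fin d) :
    ∑ ε : ℤˣ, potential b a (x + Pi.single i (ε : ℤ))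
      = (‖toEuclid x‖ ^ 2 + b + 1 + 2 * x i) ^ (-a)
        + (‖toEuclid x‖ ^ 2 + b + 1 - 2 * x i) ^ (-a) := by
  simp only [potential, norm_toEuclid_add_single_sq, sum_units_int]
  congr 2 <;> · push_cast; ring

lemma expansion_error_lt {a b s D K : ℝ} (ha : 0 < a) (haD : 2 * (a + 1) ≤ D) (hK : 0 < K)
    (hs : 0 ≤ s) (hb : 0 < b) (hbK : K < b * (2 * D * a)) :
    4 * a * (a + 1) / (s + b + 1) ^ 2 * s + K / (s + b + 1) ^ 3 * s < 2 * D * a / (s + b + 1) := by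
  set q : ℝ := s + b + 1
  have hq : 0 < q := by positivity
  calc 4 * a * (a + 1) / q ^ 2 * s + K / q ^ 3 * s
      = (2 * a * (2 * (a + 1)) * s * q + K * s) / q ^ 3 := by field_simp; ring
    _ ≤ (2 * a * D * s * q + K * q) / q ^ 3 := by gcongr; linarith
    _ = (2 * a * D * s + K) / q ^ 2 := by field_simp
    _ < (2 * a * D * s + 2 * D * a * (b + 1)) / q ^ 2 := by gcongr; nlinarith
    _ = 2 * D * a / q := by field_simp; simp only [q]; ring

lemma eventually_neighborMean_potential_lt (hd : 0 < d) {a : ℝ} (ha : 0 < a)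
    (had : 2 * (a + 1) ≤ d) :
    ∀ᶠ b in atTop, ∀ x : Fin d → ℤ, neighborMean (potential b a) x < potential b a x := by
  obtain ⟨K, hK, hpair⟩ := exists_eventually_add_rpow_add_sub_rpow_le a
  obtain ⟨q₀, hpair⟩ := eventually_atTop.1 hpair
  filter_upwards [eventually_gt_atTop 0, eventually_ge_atTop q₀,
    eventually_gt_atTop (K / (2 * d * a))] with b hb hbq hbK x
  rw [div_lt_iff₀ (by positivity)] at hbK
  set s : ℝ := ‖toEuclid x‖ ^ 2
  set q : ℝ := s + b + 1
  have hs0 : 0 ≤ s := sq_nonneg _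
  have hq : 1 < q := by linarith
  have hsum : s = ∑ i, (x i : ℝ) ^ 2 := EuclideanSpace.real_norm_sq_eq _
  have hcoord (i : Fin d) : ∑ ε : ℤˣ, potential b a (x + Pi.single i (ε : ℤ))
      ≤ q ^ (-a) * (2 + (4 * a * (a + 1) / q ^ 2 + K / q ^ 3) * (x i : ℝ) ^ 2) := by
    have hxi : (x i : ℝ) ^ 2 ≤ q := by
      have := Finset.single_le_sum (f := fun j => (x j : ℝ) ^ 2) (fun j _ => sq_nonneg _)
        (Finset.mem_univ i)
      linarith
    rw [sum_units_potential_add_single]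
    exact hpair q (by linarith) (x i) hxi
  have herror : 4 * a * (a + 1) / q ^ 2 * s + K / q ^ 3 * s < 2 * d * a / q :=
    expansion_error_lt ha had hK hs0 hb hbK
  calc neighborMean (potential b a) x
      ≤ (2 * d : ℝ)⁻¹ * ∑ i, q ^ (-a) *
          (2 + (4 * a * (a + 1) / q ^ 2 + K / q ^ 3) * (x i : ℝ) ^ 2) := by
        unfold neighborMean
        gcongr with i
        exact hcoord i
    _ = (2 * d : ℝ)⁻¹ * (q ^ (-a) *
          (2 * d + (4 * a * (a + 1) / q ^ 2 * s + K / q ^ 3 * s))) := by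
        rw [← Finset.mul_sum, Finset.sum_add_distrib, ← Finset.mul_sum, ← hsum, Finset.sum_const,
          Finset.card_univ, Fintype.card_fin, nsmul_eq_mul]
        ring
    _ < (2 * d : ℝ)⁻¹ * (q ^ (-a) * (2 * d + 2 * d * a / q)) := by gcongr
    _ = q ^ (-a) * (1 + a / q) := by field_simp
    _ ≤ (q - 1) ^ (-a) := rpow_neg_mul_one_add_div_le ha.le hq
    _ = potential b a x := by simp only [q, add_sub_cancel_right, potential, s]

lemma le_potential {a b r : ℝ} (ha : 0 ≤ a) (hb : 0 < b) {x : Fin d → ℤ}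
    (hx : ‖toEuclid x‖ ≤ r) : (r ^ 2 + b) ^ (-a) ≤ potential b a x :=
  Real.rpow_le_rpow_of_nonpos (by positivity) (by gcongr) (neg_nonpos.2 ha)

lemma potential_sub_le {a b r : ℝ} (ha : 0 ≤ a) (hb : 0 ≤ b) {x : Fin d → ℤ}
    (hx : 0 < ‖toEuclid x‖) (hxr : ‖toEuclid x‖ ≤ r) :
    potential b a x - (r ^ 2 + b) ^ (-a)
      ≤ a * ((r ^ 2 - ‖toEuclid x‖ ^ 2) / ‖toEuclid x‖ ^ (2 * (a + 1))) := by
  have hr : 0 < r := hx.trans_le hxr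
  have hgap : 0 ≤ r ^ 2 - ‖toEuclid x‖ ^ 2 := sub_nonneg.2 (by gcongr)
  calc potential b a x - (r ^ 2 + b) ^ (-a)
      ≤ a * (‖toEuclid x‖ ^ 2 + b) ^ (-(a + 1)) * (r ^ 2 + b - (‖toEuclid x‖ ^ 2 + b)) :=
        rpow_neg_sub_rpow_neg_le ha (by positivity) (by positivity)
    _ = a * (‖toEuclid x‖ ^ 2 + b) ^ (-(a + 1)) * (r ^ 2 - ‖toEuclid x‖ ^ 2) := by
        rw [add_sub_add_right_eq_sub]
    _ ≤ a * (‖toEuclid x‖ ^ 2) ^ (-(a + 1)) * (r ^ 2 - ‖toEuclid x‖ ^ 2) := by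
        gcongr ?_ * ?_ * ?_
        exact Real.rpow_le_rpow_of_nonpos (by positivity) (by linarith) (by linarith)
    _ = a * ((r ^ 2 - ‖toEuclid x‖ ^ 2) / ‖toEuclid x‖ ^ (2 * (a + 1))) := by
        rw [← Real.rpow_natCast _ 2, ← Real.rpow_mul hx.le, Nat.cast_ofNat, mul_neg,
          Real.rpow_neg hx.le]
        ring

end Potential

section KilledGreen

variable {Ω α : Type*}

/-- The event that the walk `Y` is at `x` at time `n` and was in `B` at all earlier times. -/
def stayThenAt (Y : ℕ → Ω → α) (B : Set α) (n : ℕ) (x : α) : Set Ω :=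
  {ω | Y n ω = x ∧ ∀ j < n, Y j ω ∈ B}

/-- The Green function of the walk `Y` killed outside `B`: the expected number of visits to `x` up
to and including the time of the first exit from `B`. -/
noncomputable def killedGreen [MeasurableSpace Ω] (μ : Measure Ω) (Y : ℕ → Ω → α) (B : Set α)
    (x : α) : ENNReal :=
  ∑' n, μ (stayThenAt Y B n x)

lemma measureReal_hitsBefore_le [MeasurableSpace Ω] {μ : Measure Ω} {Y : ℕ → Ω → α} {A B : Set α}
    (hA : A.Finite) {M : ℝ} (hM : 0 ≤ M)
    (hgreen : ∀ x ∈ A, killedGreen μ Y B x ≤ ENNReal.ofReal M) :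
    μ.real {ω | HitsBefore (fun n => Y n ω) A Bᶜ} ≤ A.ncard * M := by
  have hsub : {ω | HitsBefore (fun n => Y n ω) A Bᶜ}
      ⊆ ⋃ x ∈ hA.toFinset, ⋃ n, stayThenAt Y B n x := by
    rintro ω ⟨k, hk, hbefore⟩
    simp only [Set.mem_iUnion, hA.mem_toFinset]
    exact ⟨Y k ω, hk, k, rfl, fun j hj => Set.notMem_compl_iff.1 (hbefore j hj)⟩
  refine ENNReal.toReal_le_of_le_ofReal (by positivity) ?_
  calc μ {ω | HitsBefore (fun n => Y n ω) A Bᶜ}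
      ≤ ∑ x ∈ hA.toFinset, μ (⋃ n, stayThenAt Y B n x) :=
        (measure_mono hsub).trans (measure_biUnion_finset_le _ _)
    _ ≤ ∑ _x ∈ hA.toFinset, ENNReal.ofReal M := Finset.sum_le_sum fun _ hx =>
        (measure_iUnion_le _).trans (hgreen _ (hA.mem_toFinset.1 hx))
    _ = ENNReal.ofReal (A.ncard * M) := by
        rw [Finset.sum_const, nsmul_eq_mul, ENNReal.ofReal_mul (by positivity),
          ENNReal.ofReal_natCast, Set.ncard_eq_toFinset_card A hA]

end KilledGreen

section Walk

variable {Ω : Type*} [MeasurableSpace Ω] {μ : Measure Ω} {Y : ℕ → Ω → (Fin d → ℤ)}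
  {v : Fin d → ℤ}

namespace IsSimpleRandomWalk

lemma isProbabilityMeasure (hY : IsSimpleRandomWalk μ v Y) : IsProbabilityMeasure μ :=
  hY.indep.isProbabilityMeasure

lemma measurable_step (hY : IsSimpleRandomWalk μ v Y) (n : ℕ) :
    Measurable fun ω => Y (n + 1) ω - Y n ω :=
  (hY.measurable (n + 1)).sub (hY.measurable n)

lemma measureReal_step_eq_single (hY : IsSimpleRandomWalk μ v Y) (n : ℕ) (i : Fin d) (ε : ℤˣ) :
    μ.real {ω | Y (n + 1) ω - Y n ω = Pi.single i (ε : ℤ)} = (2 * d : ℝ)⁻¹ := by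
  obtain rfl | rfl := Int.units_eq_one_or ε
  · simpa using hY.step_pos n i
  · simpa [Pi.single_neg] using hY.step_neg n i

lemma ae_exists_step_eq_single (hd : 0 < d) (hY : IsSimpleRandomWalk μ v Y) (n : ℕ) :
    ∀ᵐ ω ∂μ, ∃ i, ∃ ε : ℤˣ, Y (n + 1) ω - Y n ω = Pi.single i (ε : ℤ) := by
  have := hY.isProbabilityMeasure
  let e : Fin d × ℤˣ → (Fin d → ℤ) := fun p => Pi.single p.1 (p.2 : ℤ)
  have he : Function.Injective e := by
    rintro ⟨i, ε⟩ ⟨j, ε'⟩ h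
    have hi := congrFun h i
    obtain rfl : i = j := by
      by_contra hij
      simp [e, hij] at hi
    simpa [e, Units.val_inj] using hi
  let S : Finset (Fin d → ℤ) := Finset.univ.map ⟨e, he⟩
  have hS : μ.real ((fun ω => Y (n + 1) ω - Y n ω) ⁻¹' S) = 1 := by
    rw [← sum_measureReal_preimage_singleton S fun y _ =>
      hY.measurable_step n (measurableSet_singleton y), Finset.sum_map]
    calc ∑ p : Fin d × ℤˣ, μ.real ((fun ω => Y (n + 1) ω - Y n ω) ⁻¹' {e p})
        = ∑ _p : Fin d × ℤˣ, (2 * d : ℝ)⁻¹ :=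
          Finset.sum_congr rfl fun p _ => hY.measureReal_step_eq_single n p.1 p.2
      _ = 1 := by
          rw [Finset.sum_const, Finset.card_univ, Fintype.card_prod, Fintype.card_fin,
            Fintype.card_units_int, nsmul_eq_mul]
          push_cast
          field_simp
  have hae : ∀ᵐ ω ∂μ, Y (n + 1) ω - Y n ω ∈ (S : Set (Fin d → ℤ)) := by
    refine (mem_ae_iff_prob_eq_one (hY.measurable_step n S.measurableSet)).2 ?_
    rw [← ofReal_measureReal, hS, ENNReal.ofReal_one]
  filter_upwards [hae] with ω hω
  obtain ⟨⟨i, ε⟩, -, h⟩ := Finset.mem_map.1 hω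
  exact ⟨i, ε, h.symm⟩

lemma indepFun_history_step (hY : IsSimpleRandomWalk μ v Y) (n : ℕ) :
    IndepFun (fun ω (j : Finset.range (n + 1)) => Y j ω) (fun ω => Y (n + 1) ω - Y n ω) μ := by
  have hsteps := hY.indep.indepFun_finset (Finset.range n) {n} (by simp) hY.measurable_step
  let path : (Finset.range n → Fin d → ℤ) → Finset.range (n + 1) → Fin d → ℤ :=
    fun w j => v + ∑ k : Finset.range n, if (k : ℕ) < j then w k else 0
  have hpath : (fun ω => path fun k => Y (k + 1) ω - Y k ω)
      =ᵐ[μ] fun ω (j : Finset.range (n + 1)) => Y j ω := by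
    filter_upwards [hY.start] with ω hstart
    ext1 j
    have hj : (j : ℕ) ≤ n := Nat.lt_succ_iff.1 (Finset.mem_range.1 j.2)
    have hfilter : (Finset.range n).filter (· < (j : ℕ)) = Finset.range j := by
      ext k
      simp only [Finset.mem_filter, Finset.mem_range, and_iff_right_iff_imp]
      omega
    simp only [path]
    rw [Finset.sum_coe_sort (Finset.range n) (fun k => if k < (j : ℕ) then
      Y (k + 1) ω - Y k ω else 0), ← Finset.sum_filter, hfilter,
      Finset.sum_range_sub (fun k => Y k ω), hstart, add_sub_cancel]
  exact (hsteps.comp (φ := path) (ψ := fun w => w ⟨n, Finset.mem_singleton_self n⟩)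
    .of_discrete (measurable_pi_apply _)).congr hpath ae_eq_rfl

lemma measure_stayThenAt_inter_step (hY : IsSimpleRandomWalk μ v Y) (B : Set (Fin d → ℤ))
    (n : ℕ) (x e : Fin d → ℤ) :
    μ (stayThenAt Y B n x ∩ {ω | Y (n + 1) ω - Y n ω = e})
      = μ (stayThenAt Y B n x) * μ {ω | Y (n + 1) ω - Y n ω = e} := by
  let S : Set (Finset.range (n + 1) → Fin d → ℤ) :=
    {w | w ⟨n, by simp⟩ = x ∧ ∀ j (hj : j < n), w ⟨j, by simp; omega⟩ ∈ B}
  exact (hY.indepFun_history_step n).measure_inter_preimage_eq_mul S {e}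
    (.of_discrete) (.of_discrete)

lemma measureReal_stayThenAt_zero_le (hY : IsSimpleRandomWalk μ v Y) (B : Set (Fin d → ℤ))
    (x : Fin d → ℤ) : μ.real (stayThenAt Y B 0 x) ≤ Set.indicator {v} 1 x := by
  have := hY.isProbabilityMeasure
  obtain rfl | hx := eq_or_ne x v
  · simp
  · have hnull : μ (stayThenAt Y B 0 x) = 0 := by
      rw [measure_eq_zero_iff_ae_notMem]
      filter_upwards [hY.start] with ω hstart hω
      exact hx (hω.1.symm.trans hstart)
    simp [measureReal_def, hnull, hx]

lemma measureReal_stayThenAt_succ_le (hd : 0 < d) (hY : IsSimpleRandomWalk μ v Y)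
    (B : Set (Fin d → ℤ)) (n : ℕ) (x : Fin d → ℤ) :
    μ.real (stayThenAt Y B (n + 1) x)
      ≤ neighborMean (B.indicator fun y => μ.real (stayThenAt Y B n y)) x := by
  classical
  have := hY.isProbabilityMeasure
  let E (i : Fin d) (ε : ℤˣ) : Set Ω := {ω | x + Pi.single i (ε : ℤ) ∈ B} ∩
    (stayThenAt Y B n (x + Pi.single i (ε : ℤ))
      ∩ {ω | Y (n + 1) ω - Y n ω = Pi.single i ((-ε : ℤˣ) : ℤ)})
  have hcover : stayThenAt Y B (n + 1) x ≤ᵐ[μ] (⋃ i, ⋃ ε, E i ε : Set Ω) := by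
    filter_upwards [hY.ae_exists_step_eq_single hd n] with ω ⟨i, ε, hstep⟩ ⟨hend, hstay⟩
    have hprev : Y n ω = x + Pi.single i ((-ε : ℤˣ) : ℤ) := by
      rw [Units.val_neg, Pi.single_neg, ← hstep, ← hend]; abel
    refine Set.mem_iUnion₂.2 ⟨i, -ε, ?_, ⟨hprev, fun j hj => hstay j (by omega)⟩, ?_⟩
    · exact hprev ▸ hstay n n.lt_succ_self
    · rwa [neg_neg]
  have hE (i : Fin d) (ε : ℤˣ) : μ.real (E i ε) ≤ (2 * d : ℝ)⁻¹ *
      B.indicator (fun y => μ.real (stayThenAt Y B n y)) (x + Pi.single i (ε : ℤ)) := by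
    by_cases hB : x + Pi.single i (ε : ℤ) ∈ B
    · refine (measureReal_mono Set.inter_subset_right).trans (le_of_eq ?_)
      rw [Set.indicator_of_mem hB, measureReal_def, hY.measure_stayThenAt_inter_step,
        ENNReal.toReal_mul, ← measureReal_def, ← measureReal_def, hY.measureReal_step_eq_single,
        mul_comm]
    · simp [E, hB]
  calc μ.real (stayThenAt Y B (n + 1) x) ≤ μ.real (⋃ i, ⋃ ε, E i ε) :=
        ENNReal.toReal_mono (measure_ne_top _ _) (measure_mono_ae hcover)
    _ ≤ ∑ i, ∑ ε, μ.real (E i ε) := (measureReal_iUnion_fintype_le _).trans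
        (Finset.sum_le_sum fun i _ => measureReal_iUnion_fintype_le _)
    _ ≤ neighborMean (B.indicator fun y => μ.real (stayThenAt Y B n y)) x := by
        simp only [neighborMean, Finset.mul_sum]
        gcongr with i _ ε _
        exact hE i ε

/-- `(F - m) / (F v - neighborMean F v)` is a supersolution of the equation that defines the killed
Green function. -/
lemma killedGreen_le_of_superharmonic (hd : 0 < d) (hY : IsSimpleRandomWalk μ v Y)
    {B : Set (Fin d → ℤ)} {F : (Fin d → ℤ) → ℝ} {m : ℝ} (hF : ∀ x ∈ B, neighborMean F x ≤ F x)
    (hFv : neighborMean F v < F v) (hm : ∀ x ∈ B, m ≤ F x)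
    (hm_neighbor : ∀ x ∈ B, ∀ i, ∀ ε : ℤˣ, m ≤ F (x + Pi.single i (ε : ℤ)))
    {x : Fin d → ℤ} (hx : x ∈ B) :
    killedGreen μ Y B x ≤ ENNReal.ofReal ((F v - neighborMean F v)⁻¹ * (F x - m)) := by
  have := hY.isProbabilityMeasure
  set A : ℝ := (F v - neighborMean F v)⁻¹
  have hA : 0 < A := inv_pos.2 (sub_pos.2 hFv)
  refine ENNReal.tsum_le_of_sum_range_le fun N => ?_
  have hsum : ∑ n ∈ Finset.range N, μ.real (stayThenAt Y B n x) ≤ A * (F x - m) := by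
    refine sum_range_le_of_supersolution (p := fun n y => μ.real (stayThenAt Y B n y))
      (g := Set.indicator {v} 1) (H := fun y => A * (F y - m))
      (fun y _ => hY.measureReal_stayThenAt_zero_le B y)
      (fun n y _ => hY.measureReal_stayThenAt_succ_le hd B n y)
      (fun y hy => mul_nonneg hA.le (sub_nonneg.2 (hm y hy))) (fun y hy => ?_) N x hx
    have hmean : neighborMean (B.indicator fun y => A * (F y - m)) y
        ≤ A * (neighborMean F y - m) := by
      rw [← neighborMean_mul_sub hd]
      exact neighborMean_le_neighborMean fun i ε => Set.indicator_le_self'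
        (fun _ _ => mul_nonneg hA.le (sub_nonneg.2 (hm_neighbor y hy i ε))) _
    have hdrop : Set.indicator {v} 1 y ≤ A * (F y - neighborMean F y) := by
      obtain rfl | hyv := eq_or_ne y v
      · simp [A, inv_mul_cancel₀ (sub_pos.2 hFv).ne']
      · simpa [hyv] using mul_nonneg hA.le (sub_nonneg.2 (hF y hy))
    linarith
  calc ∑ n ∈ Finset.range N, μ (stayThenAt Y B n x)
      = ENNReal.ofReal (∑ n ∈ Finset.range N, μ.real (stayThenAt Y B n x)) := by
        simp [ENNReal.ofReal_sum_of_nonneg]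
    _ ≤ ENNReal.ofReal (A * (F x - m)) := ENNReal.ofReal_le_ofReal hsum

end IsSimpleRandomWalk

end Walk

lemma exists_killedGreen_le (hd : 3 ≤ d) (v : Fin d → ℤ) :
    ∃ A : ℝ, 0 ≤ A ∧ ∀ {Ω : Type*} [MeasurableSpace Ω] {μ : Measure Ω} {Y : ℕ → Ω → (Fin d → ℤ)},
      IsSimpleRandomWalk μ v Y → ∀ (ρ : ℝ) (x : Fin d → ℤ), 0 < ‖toEuclid x‖ → ‖toEuclid x‖ ≤ ρ →
        killedGreen μ Y (lattice (Metric.closedBall 0 ρ)) x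
          ≤ ENNReal.ofReal (A * (((ρ + 1) ^ 2 - ‖toEuclid x‖ ^ 2) / ‖toEuclid x‖ ^ d)) := by
  have hd0 : 0 < d := by omega
  have hd3 : (3 : ℝ) ≤ d := by exact_mod_cast hd
  set a : ℝ := ((d : ℝ) - 2) / 2
  have ha : 0 < a := by simp only [a]; linarith
  have had : 2 * (a + 1) = d := by simp only [a]; ring
  obtain ⟨b, hF, hb⟩ := ((eventually_neighborMean_potential_lt hd0 ha had.le).and
    (eventually_gt_atTop 0)).exists
  have hA : 0 < (potential b a v - neighborMean (potential b a) v)⁻¹ :=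
    inv_pos.2 (sub_pos.2 (hF v))
  refine ⟨(potential b a v - neighborMean (potential b a) v)⁻¹ * a, by positivity,
    fun {Ω _ μ Y} hY ρ x hx hxρ => ?_⟩
  have hball {y : Fin d → ℤ} (hy : y ∈ lattice (Metric.closedBall 0 ρ)) : ‖toEuclid y‖ ≤ ρ :=
    mem_closedBall_zero_iff.1 hy
  refine (hY.killedGreen_le_of_superharmonic hd0 (m := ((ρ + 1) ^ 2 + b) ^ (-a))
    (fun y _ => (hF y).le) (hF v)
    (fun y hy => le_potential ha.le hb ((hball hy).trans (by linarith)))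
    (fun y hy i ε => le_potential ha.le hb
      ((norm_toEuclid_add_single_le y i ε).trans (by linarith [hball hy])))
    (mem_closedBall_zero_iff.2 hxρ)).trans (ENNReal.ofReal_le_ofReal ?_)
  rw [mul_assoc, ← Real.rpow_natCast ‖toEuclid x‖ d, ← had]
  exact mul_le_mul_of_nonneg_left (potential_sub_le ha.le hb.le hx (by linarith)) hA.le

section Counting

lemma card_Icc_ceil_floor_le (z : ℝ) {w : ℝ} (hw : 0 ≤ w) :
    ((Finset.Icc ⌈z - w⌉ ⌊z + w⌋).card : ℝ) ≤ 2 * w + 1 := by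
  rw [Int.card_Icc, ← Int.cast_natCast (R := ℝ), Int.toNat_eq_max]
  push_cast
  exact max_le (by linarith [Int.floor_le (z + w), Int.le_ceil (z - w)]) (by linarith)

lemma lattice_closedBall_subset (z : EuclideanSpace ℝ (Fin d)) (w : ℝ) :
    lattice (Metric.closedBall z w)
      ⊆ (Fintype.piFinset fun i => Finset.Icc ⌈z i - w⌉ ⌊z i + w⌋ : Finset (Fin d → ℤ)) := by
  intro x hx
  simp only [Finset.mem_coe, Fintype.mem_piFinset, Finset.mem_Icc, Int.ceil_le, Int.le_floor]
  intro i
  have hi : |(x i : ℝ) - z i| ≤ w :=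
    (PiLp.norm_apply_le (toEuclid x - z) i).trans (mem_closedBall_iff_norm.1 hx)
  constructor <;> linarith [(abs_le.1 hi).1, (abs_le.1 hi).2]

lemma finite_lattice_closedBall (z : EuclideanSpace ℝ (Fin d)) (w : ℝ) :
    (lattice (Metric.closedBall z w)).Finite :=
  (Finset.finite_toSet _).subset (lattice_closedBall_subset z w)

lemma ncard_lattice_closedBall_le (z : EuclideanSpace ℝ (Fin d)) {w : ℝ} (hw : 0 ≤ w) :
    ((lattice (Metric.closedBall z w)).ncard : ℝ) ≤ (2 * w + 1) ^ d :=
  calc ((lattice (Metric.closedBall z w)).ncard : ℝ)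
      ≤ ∏ i, ((Finset.Icc ⌈z i - w⌉ ⌊z i + w⌋).card : ℝ) := by
        have h := Set.ncard_le_ncard (lattice_closedBall_subset z w)
        rw [Set.ncard_coe_finset, Fintype.card_piFinset] at h
        exact_mod_cast h
    _ ≤ ∏ _i : Fin d, (2 * w + 1) := by gcongr with i; exact card_Icc_ceil_floor_le _ hw
    _ = (2 * w + 1) ^ d := by simp

lemma norm_sub_smul_le {E : Type*} [NormedAddCommGroup E] [NormedSpace ℝ E] {y t : E} (hy : y ≠ 0)
    (ht : ‖t‖ = 1) (r : ℝ) : ‖y - r • t‖ ≤ ‖y‖ * ‖‖y‖⁻¹ • y - t‖ + |‖y‖ - r| :=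
  calc ‖y - r • t‖ = ‖‖y‖ • (‖y‖⁻¹ • y - t) + (‖y‖ - r) • t‖ := by
        rw [smul_sub, smul_inv_smul₀ (norm_ne_zero_iff.2 hy)]
        congr 1
        module
    _ ≤ ‖‖y‖ • (‖y‖⁻¹ • y - t)‖ + ‖(‖y‖ - r) • t‖ := norm_add_le _ _
    _ = ‖y‖ * ‖‖y‖⁻¹ • y - t‖ + |‖y‖ - r| := by
        rw [norm_smul, norm_smul, norm_norm, ht, mul_one, Real.norm_eq_abs]

variable {R L c δ : ℝ} {T : Set (EuclideanSpace ℝ (Fin d))}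

lemma exists_cell_subset_iUnion_closedBall (hR : 0 < R) (hLR : L ≤ δ * R)
    (hT : ∀ x ∈ T, ∀ y ∈ T, ‖x - y‖ ≤ c / R) :
    ∃ t, cell (annulus d (R + L) R) T
      ⊆ ⋃ k ∈ Finset.range (⌊L⌋₊ + 1), Metric.closedBall ((R + k) • t) ((1 + δ) * c + 1) := by
  obtain hempty | ⟨y₀, ⟨-, hy₀⟩, hy₀T⟩ := (cell (annulus d (R + L) R) T).eq_empty_or_nonempty
  · simp [hempty]
  have hnorm {y : EuclideanSpace ℝ (Fin d)} (hy : y ∉ Metric.ball 0 R) : R ≤ ‖y‖ := by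
    simpa using hy
  have hy₀_ne : y₀ ≠ 0 := norm_pos_iff.1 (hR.trans_le (hnorm hy₀))
  have ht₀ : ‖‖y₀‖⁻¹ • y₀‖ = 1 := norm_smul_inv_norm hy₀_ne
  replace hy₀T : ‖y₀‖⁻¹ • y₀ ∈ T := hy₀T
  generalize ‖y₀‖⁻¹ • y₀ = t at ht₀ hy₀T
  refine ⟨t, fun y ⟨⟨hy_le, hy_ge⟩, hyT⟩ => ?_⟩
  replace hy_le : ‖y‖ ≤ R + L := mem_closedBall_zero_iff.1 hy_le
  replace hy_ge : R ≤ ‖y‖ := hnorm hy_ge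
  have hy_ne : y ≠ 0 := norm_pos_iff.1 (hR.trans_le hy_ge)
  refine Set.mem_iUnion₂.2 ⟨⌊‖y‖ - R⌋₊, ?_, mem_closedBall_iff_norm.2 ?_⟩
  · rw [Finset.mem_range, Nat.lt_succ_iff]
    exact Nat.floor_mono (by linarith)
  have hradial : |‖y‖ - (R + ⌊‖y‖ - R⌋₊)| ≤ 1 := by
    rw [← sub_sub, abs_of_nonneg (sub_nonneg.2 (Nat.floor_le (sub_nonneg.2 hy_ge)))]
    linarith [Nat.lt_floor_add_one (‖y‖ - R)]
  have hangular : ‖y‖ * ‖‖y‖⁻¹ • y - t‖ ≤ (1 + δ) * c :=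
    calc ‖y‖ * ‖‖y‖⁻¹ • y - t‖ ≤ (1 + δ) * R * (c / R) :=
          mul_le_mul (by linarith) (hT _ hyT _ hy₀T) (norm_nonneg _) (by linarith)
      _ = (1 + δ) * c := by field_simp
  exact (norm_sub_smul_le hy_ne ht₀ _).trans (add_le_add hangular hradial)

lemma finite_lattice_cell_annulus : (lattice (cell (annulus d R L) T)).Finite :=
  (finite_lattice_closedBall 0 R).subset fun _ hx => hx.1.1

lemma ncard_lattice_cell_annulus_le (hR : 0 < R) (hL : 0 ≤ L) (hLR : L ≤ δ * R) (hc : 0 ≤ c)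
    (hT : ∀ x ∈ T, ∀ y ∈ T, ‖x - y‖ ≤ c / R) :
    ((lattice (cell (annulus d (R + L) R) T)).ncard : ℝ)
      ≤ (L + 1) * (2 * ((1 + δ) * c + 1) + 1) ^ d := by
  have hδ : 0 ≤ δ := nonneg_of_mul_nonneg_left (hL.trans hLR) hR
  set w : ℝ := (1 + δ) * c + 1
  obtain ⟨t, hcover⟩ := exists_cell_subset_iUnion_closedBall hR hLR hT
  have hlattice : lattice (cell (annulus d (R + L) R) T)
      ⊆ ⋃ k ∈ Finset.range (⌊L⌋₊ + 1), lattice (Metric.closedBall ((R + (k : ℕ)) • t) w) := by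
    intro x hx
    obtain ⟨k, hk, hxk⟩ := Set.mem_iUnion₂.1 (hcover hx)
    exact Set.mem_iUnion₂.2 ⟨k, hk, hxk⟩
  have hncard := (Set.ncard_le_ncard hlattice ((Finset.finite_toSet _).biUnion fun k _ =>
    finite_lattice_closedBall _ w)).trans (Finset.set_ncard_biUnion_le _ _)
  calc ((lattice (cell (annulus d (R + L) R) T)).ncard : ℝ)
      ≤ ∑ k ∈ Finset.range (⌊L⌋₊ + 1),
          ((lattice (Metric.closedBall ((R + (k : ℕ)) • t) w)).ncard : ℝ) := by
        exact_mod_cast hncard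
    _ ≤ ∑ k ∈ Finset.range (⌊L⌋₊ + 1), (2 * w + 1) ^ d := by
        gcongr; exact ncard_lattice_closedBall_le _ (by positivity)
    _ = (⌊L⌋₊ + 1) * (2 * w + 1) ^ d := by simp
    _ ≤ (L + 1) * (2 * w + 1) ^ d := by gcongr; exact Nat.floor_le hL

end Counting

lemma HitsBefore.mono {α : Type*} {y : ℕ → α} {A B B' : Set α} (hB : B' ⊆ B)
    (h : HitsBefore y A B) : HitsBefore y A B' :=
  let ⟨k, hk, hbefore⟩ := h
  ⟨k, hk, fun j hj hj' => hbefore j hj (hB hj')⟩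

lemma sq_sub_sq_div_pow_le {δ R ℓ r : ℝ} (hd : 0 < d) (hδ : 0 ≤ δ) (hℓ : 1 ≤ ℓ) (hℓR : ℓ ≤ R)
    (hr : R ≤ r) :
    ((R + δ * ℓ + 1) ^ 2 - r ^ 2) / r ^ d ≤ (δ + 1) * (δ + 3) * (ℓ / R ^ (d - 1)) := by
  have hR : 0 < R := by linarith
  have hδℓ : δ * ℓ ≤ δ * R := mul_le_mul_of_nonneg_left hℓR hδ
  have hδℓ0 : 0 ≤ δ * ℓ := by positivity
  calc ((R + δ * ℓ + 1) ^ 2 - r ^ 2) / r ^ d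
      ≤ ((R + δ * ℓ + 1) ^ 2 - R ^ 2) / R ^ d := by
        have hgap : R ^ 2 ≤ (R + δ * ℓ + 1) ^ 2 := by gcongr; linarith
        gcongr
    _ = (δ * ℓ + 1) * (2 * R + δ * ℓ + 1) / R ^ d := by ring
    _ ≤ (δ + 1) * ℓ * ((δ + 3) * R) / R ^ d := by gcongr <;> linarith
    _ = (δ + 1) * (δ + 3) * (ℓ / R ^ (d - 1)) := by
        rw [← Nat.sub_one_add_one hd.ne', Nat.add_sub_cancel, pow_succ]
        field_simp

lemma sqrt_log_mem_Icc {R : ℝ} (hR : Real.exp 1 ≤ R) :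
    √(Real.log R) ∈ Set.Icc 1 R := by
  have hR0 : 0 < R := (Real.exp_pos 1).trans_le hR
  refine ⟨Real.one_le_sqrt.2 ((Real.le_log_iff_exp_le hR0).2 hR), Real.sqrt_le_iff.2 ⟨hR0.le, ?_⟩⟩
  nlinarith [Real.log_le_sub_one_of_pos hR0]

end SRWCell

open SRWCell in
theorem lemma3p4_general {d : ℕ} (hd : 3 ≤ d) (v : Fin d → ℤ) {δ c : ℝ} (hδ : 0 ≤ δ) (hc : 0 ≤ c) :
    ∃ C : ℝ, ∀ R ℓ : ℝ, 1 ≤ ℓ → ℓ ≤ R →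
      ∀ T : Set (EuclideanSpace ℝ (Fin d)), (∀ x ∈ T, ∀ y ∈ T, ‖x - y‖ ≤ c / R) →
      ∀ (Ω : Type*) [MeasurableSpace Ω] (μ : Measure Ω) (Y : ℕ → Ω → (Fin d → ℤ)),
        IsSimpleRandomWalk μ v Y →
        μ.real {ω | HitsBefore (fun n => Y n ω)
            (lattice (cell (annulus d (R + δ * ℓ) R) T)) (latticeBall d (R + δ * ℓ))ᶜ}
          ≤ C * (ℓ ^ 2 / R ^ (d - 1)) := by
  obtain ⟨A, hA, hgreen⟩ := exists_killedGreen_le hd v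
  refine ⟨(δ + 1) * (2 * ((1 + δ) * c + 1) + 1) ^ d * (A * ((δ + 1) * (δ + 3))),
    fun R ℓ hℓ hℓR T hT Ω _ μ Y hY => ?_⟩
  have hR : 0 < R := by linarith
  have := hY.isProbabilityMeasure
  set S := lattice (cell (annulus d (R + δ * ℓ) R) T)
  set M : ℝ := A * ((δ + 1) * (δ + 3) * (ℓ / R ^ (d - 1)))
  have hvisits : ∀ x ∈ S,
      killedGreen μ Y (lattice (Metric.closedBall 0 (R + δ * ℓ))) x ≤ ENNReal.ofReal M := by
    rintro x ⟨⟨hx_le, hx_ge⟩, -⟩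
    replace hx_le : ‖toEuclid x‖ ≤ R + δ * ℓ := mem_closedBall_zero_iff.1 hx_le
    replace hx_ge : R ≤ ‖toEuclid x‖ := by simpa using hx_ge
    refine (hgreen hY _ x (by linarith) hx_le).trans (ENNReal.ofReal_le_ofReal ?_)
    exact mul_le_mul_of_nonneg_left (sq_sub_sq_div_pow_le (by omega) hδ hℓ hℓR hx_ge) hA
  have hcard : (S.ncard : ℝ) ≤ (δ + 1) * ℓ * (2 * ((1 + δ) * c + 1) + 1) ^ d :=
    (ncard_lattice_cell_annulus_le hR (by positivity)
      (mul_le_mul_of_nonneg_left hℓR hδ) hc hT).trans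
      (mul_le_mul_of_nonneg_right (by linarith) (by positivity))
  calc μ.real {ω | HitsBefore (fun n => Y n ω) S (latticeBall d (R + δ * ℓ))ᶜ}
      ≤ μ.real {ω | HitsBefore (fun n => Y n ω) S (lattice (Metric.closedBall 0 (R + δ * ℓ)))ᶜ} :=
        measureReal_mono fun ω => HitsBefore.mono
          (Set.compl_subset_compl.2 fun _ hx => Metric.ball_subset_closedBall hx)
    _ ≤ S.ncard * M :=
        measureReal_hitsBefore_le finite_lattice_cell_annulus (by positivity) hvisits
    _ ≤ (δ + 1) * ℓ * (2 * ((1 + δ) * c + 1) + 1) ^ d * M := by gcongr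
    _ = _ := by simp only [M]; ring

theorem lemma3p4 (d : ℕ) (hd : 3 ≤ d) :
    ∃ R₁ : ℝ, ∀ δ cp : ℝ, 1 < δ → 1 < cp → ∃ C' : ℝ, ∀ R : ℝ, 1 < R → R₁ < R →
      ∀ T : Set (EuclideanSpace ℝ (Fin d)), IsClosed T →
        T ⊆ Metric.sphere (0 : EuclideanSpace ℝ (Fin d)) 1 →
        (∀ x ∈ T, ∀ y ∈ T, ‖x - y‖ ≤ cp / R) →
      ∀ (Ω : Type*) [MeasurableSpace Ω] (μ : Measure Ω) [IsProbabilityMeasure μ]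
        (Y : ℕ → Ω → (Fin d → ℤ)), SRWCell.IsSimpleRandomWalk μ 0 Y →
        μ.real {ω | SRWCell.HitsBefore (fun n => Y n ω)
            (SRWCell.lattice
              (SRWCell.cell (SRWCell.annulus d (R + δ * √(Real.log R)) R) T))
            (SRWCell.latticeBall d (R + δ * √(Real.log R)))ᶜ}
          ≤ C' * (Real.log R / R ^ (d - 1)) := by
  refine ⟨Real.exp 1, fun δ cp hδ hcp => ?_⟩
  obtain ⟨C, hC⟩ := lemma3p4_general hd 0 (zero_le_one.trans hδ.le) (zero_le_one.trans hcp.le)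
  refine ⟨C, fun R hR hR₁ T _ _ hT Ω _ μ _ Y hY => ?_⟩
  obtain ⟨hℓ, hℓR⟩ := SRWCell.sqrt_log_mem_Icc hR₁.le
  simpa only [Real.sq_sqrt (Real.log_pos hR).le] using hC R _ hℓ hℓR T hT Ω μ Y hY
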